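/- All graphs are finite and simple. A graph is *homogeneously traceable* if every vertex is an endpoint of a Hamilton path; the *circumference* of a graph is the length of a longest cycle. **Theorem 3.** For every even integer $n\ge 10$ there exists a cubic (that is, $3$-regular) homogeneously traceable nonhamiltonian graph of order $n$; and for every integer $p\ge 18$ there exists a $4$-regular homogeneously traceable graph of order $p$ and circumference $p-4$. -/

import Mathlib

namespace SimpleGraph

/-- A graph is homogeneously traceable if every vertex is an endpoint of a Hamilton path. -/
def HomogeneouslyTraceable {V : Type*} [DecidableEq V] (G : SimpleGraph V) : Prop :=
  ∀ v : V, ∃ (w : V) (p : G.Walk v w), p.IsHamiltonian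

/-- The set of lengths of the cycles of a graph. -/
def cycleLengths {V : Type*} (G : SimpleGraph V) : Set ℕ :=
  {k | ∃ (v : V) (p : G.Walk v v), p.IsCycle ∧ p.length = k}

/-- Cycle lengths in a finite graph are bounded by the order, so that the supremum below is
the length of a longest cycle as soon as there is a cycle. -/
theorem bddAbove_cycleLengths {V : Type*} [Finite V] (G : SimpleGraph V) :
    BddAbove G.cycleLengths := by
  have := Fintype.ofFinite V
  refine ⟨Fintype.card V, ?_⟩
  rintro k ⟨v, p, hp, rfl⟩
  have h := hp.support_nodup.length_le_card
  simpa using h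

/-- The circumference of a finite graph: the length of a longest cycle
(`0` if the graph has no cycle). -/
noncomputable def circumference {V : Type*} [Finite V] (G : SimpleGraph V) : ℕ :=
  sSup G.cycleLengths

end SimpleGraph

/-! Cubic part. The Petersen graph settles order 10, and replacing a vertex `v` by a triangle adds
two vertices and keeps the graph cubic. A connected 2-factor of the new graph contracts to one of
the old graph (`NoConnectedTwoFactor.expand`), so nonhamiltonicity persists. A Hamilton path through
`v` extends, because the triangle can be traversed between any two of its outer edges. Paths that
start in the triangle need Hamilton paths of the old graph leaving `v` by two different edges;
`IsCubicSeed` carries such a vertex along, and `IsCubicSeed.exists_expand` closes the induction.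

4-regular part. Three arms, each close to the square of a path, are joined by a triangle on their
first vertices and a triangle on their last vertices. Any arm has a Hamilton path from any vertex
other than its last one to its last one, which gives traceability. A cycle visiting all three
interiors would pair off the three first vertices, which is impossible since 3 is odd
(`armGraph_exists_missed`). So every cycle misses an interior, hence at least four vertices, and
exactly four can be missed when one arm has six vertices. -/

namespace SimpleGraph

/-! ### Paths with a prescribed vertex set -/

variable {V W : Type*} {G : SimpleGraph V}

/-- There is a path from `u` to `v` whose vertex set is exactly `S`. -/
def PathOn (G : SimpleGraph V) (S : Set V) (u v : V) : Prop :=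
  ∃ p : G.Walk u v, p.IsPath ∧ ∀ w, w ∈ p.support ↔ w ∈ S

namespace PathOn

theorem singleton (u : V) : G.PathOn {u} u u :=
  ⟨.nil, .nil, by simp⟩

theorem symm {S : Set V} {u v : V} (h : G.PathOn S u v) : G.PathOn S v u := by
  obtain ⟨p, hp, hS⟩ := h
  exact ⟨p.reverse, hp.reverse, by simpa using hS⟩

theorem append {S T : Set V} {u v w x : V} (h : G.PathOn S u v) (hvw : G.Adj v w)
    (h' : G.PathOn T w x) (hST : Disjoint S T) : G.PathOn (S ∪ T) u x := by
  obtain ⟨p, hp, hS⟩ := h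
  obtain ⟨q, hq, hT⟩ := h'
  refine ⟨p.append (.cons hvw q), ?_, fun y => ?_⟩
  · rw [Walk.isPath_def, Walk.support_append, Walk.support_cons, List.tail_cons,
      List.nodup_append]
    refine ⟨hp.support_nodup, hq.support_nodup, fun a ha b hb hab => ?_⟩
    subst hab
    exact Set.disjoint_left.mp hST ((hS a).1 ha) ((hT a).1 hb)
  · rw [Walk.support_append, Walk.support_cons, List.tail_cons, List.mem_append, hS, hT]
    rfl

theorem cons {T : Set V} {u w x : V} (huw : G.Adj u w) (h : G.PathOn T w x) (hu : u ∉ T) :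
    G.PathOn (insert u T) u x :=
  (singleton u).append huw h (by simpa using hu)

theorem congr {S T : Set V} {u v : V} (h : G.PathOn S u v) (hST : ∀ w, w ∈ S ↔ w ∈ T) :
    G.PathOn T u v := by
  rwa [Set.ext hST] at h

/-- Adjacency has to be preserved only inside `S`: the inclusion of a graph into its expansion at
`v` is not a homomorphism, but it behaves like one away from `v`. -/
theorem map {G' : SimpleGraph W} (f : V ↪ W) {S : Set V} {u v : V} (h : G.PathOn S u v)
    (hf : ∀ x ∈ S, ∀ y ∈ S, G.Adj x y → G'.Adj (f x) (f y)) :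
    G'.PathOn (f '' S) (f u) (f v) := by
  obtain ⟨p, hp, hS⟩ := h
  induction p generalizing S with
  | nil =>
    refine (singleton _).congr fun w => ?_
    simp only [Walk.support_nil, List.mem_singleton] at hS
    simp [← hS, eq_comm]
  | @cons a b c hab q ih =>
    rw [Walk.cons_isPath_iff] at hp
    have hS' : ∀ w, w ∈ S ↔ w = a ∨ w ∈ q.support := by simp [← hS]
    have := ih (S := {w | w ∈ q.support})
      (fun x hx y hy => hf x ((hS' x).2 (.inr hx)) y ((hS' y).2 (.inr hy))) hp.1 (by simp)
    refine (this.cons (hf a ((hS' a).2 (.inl rfl)) b ((hS' b).2 (.inr (by simp))) hab)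
      ?_).congr fun w => ?_
    · simpa using hp.2
    · simp only [Set.mem_insert_iff, Set.mem_image, hS', Set.mem_ofPred_eq]
      constructor
      · rintro (rfl | ⟨x, hx, rfl⟩)
        · exact ⟨a, .inl rfl, rfl⟩
        · exact ⟨x, .inr hx, rfl⟩
      · rintro ⟨x, rfl | hx, rfl⟩
        · exact .inl rfl
        · exact .inr ⟨x, hx, rfl⟩

/-- A path through `v` that does not start at `v` either ends at `v` or splits there. -/
theorem split {S : Set V} {u v w : V} (h : G.PathOn S u w) (hv : v ∈ S) (huv : u ≠ v) :
    ∃ s A, G.PathOn A u s ∧ G.Adj s v ∧ v ∉ A ∧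
      ((∀ y, y ∈ S ↔ y = v ∨ y ∈ A) ∨ ∃ t B, G.PathOn B t w ∧ G.Adj v t ∧ v ∉ B ∧
        Disjoint A B ∧ ∀ y, y ∈ S ↔ y = v ∨ y ∈ A ∨ y ∈ B) := by
  obtain ⟨p, hp, hS⟩ := h
  induction p generalizing S with
  | nil => simp [← hS] at hv; exact absurd hv.symm huv
  | @cons a b c hab q ih =>
    rw [Walk.cons_isPath_iff] at hp
    have hS' : ∀ w, w ∈ S ↔ w = a ∨ w ∈ q.support := by simp [← hS]
    by_cases hbv : b = v
    · subst hbv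
      refine ⟨a, {a}, singleton a, hab, by simpa using huv.symm, ?_⟩
      cases q with
      | nil => left; intro y; simp [hS', or_comm]
      | @cons _ d _ hbd r =>
        right
        rw [Walk.cons_isPath_iff] at hp
        refine ⟨d, {w | w ∈ r.support}, ⟨r, hp.1.1, by simp⟩, hbd, hp.1.2, ?_, ?_⟩
        · have := hp.2
          simp at this
          simpa using this.2
        · intro y
          simp [hS']
          tauto
    · have hvq : v ∈ q.support := ((hS' v).1 hv).resolve_left huv.symm
      obtain ⟨s, A, hA, hsv, hvA, h⟩ := ih (S := {w | w ∈ q.support}) hvq hbv hp.1 (by simp)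
      have haA : a ∉ A := fun ha => hp.2 <| by
        rcases h with h | ⟨t, B, -, -, -, -, h⟩
        · exact (h a).2 (.inr ha)
        · exact (h a).2 (.inr (.inl ha))
      refine ⟨s, insert a A, hA.cons hab haA, hsv, by simp [huv.symm, hvA], ?_⟩
      rcases h with h | ⟨t, B, hB, hvt, hvB, hAB, h⟩
      · left
        intro y
        have := h y
        simp only [Set.mem_ofPred_eq] at this
        rw [hS', this, Set.mem_insert_iff]
        tauto
      · right
        refine ⟨t, B, hB, hvt, hvB, ?_, fun y => ?_⟩
        · rw [Set.disjoint_insert_left]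
          exact ⟨fun ha => hp.2 ((h a).2 (.inr (.inr ha))), hAB⟩
        · have := h y
          simp only [Set.mem_ofPred_eq] at this
          rw [hS', this, Set.mem_insert_iff]
          tauto

theorem exists_isHamiltonian [DecidableEq V] {u v : V} (h : G.PathOn Set.univ u v) :
    ∃ p : G.Walk u v, p.IsHamiltonian := by
  obtain ⟨p, hp, hS⟩ := h
  exact ⟨p, hp.isHamiltonian_of_mem fun w => (hS w).2 trivial⟩

/-- A path closed up by an edge is a cycle. -/
theorem ncard_mem_cycleLengths {S : Set V} {u v : V} (h : G.PathOn S u v) (hvu : G.Adj v u)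
    (hS : 3 ≤ S.ncard) : S.ncard ∈ G.cycleLengths := by
  classical
  obtain ⟨p, hp, hpS⟩ := h
  have hcard : S.ncard = p.length + 1 := by
    have : S = (p.support.toFinset : Set V) := by ext; simp [hpS]
    rw [this, Set.ncard_coe_finset, List.toFinset_card_of_nodup hp.support_nodup,
      Walk.length_support]
  refine ⟨v, .cons hvu p, ?_, by simp [hcard]⟩
  rw [Walk.isCycle_iff_isPath_tail_and_le_length]
  refine ⟨by simpa using hp, ?_⟩
  rw [Walk.length_cons]
  omega

end PathOn

theorem homogeneouslyTraceable_of_pathOn [DecidableEq V]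
    (h : ∀ v, ∃ w, G.PathOn Set.univ v w) : G.HomogeneouslyTraceable := fun v =>
  let ⟨w, hw⟩ := h v
  ⟨w, hw.exists_isHamiltonian⟩

namespace Iso

theorem homogeneouslyTraceable {G' : SimpleGraph W} [DecidableEq V] [DecidableEq W] (e : G ≃g G')
    (h : G.HomogeneouslyTraceable) :
    G'.HomogeneouslyTraceable := by
  intro v
  obtain ⟨w, p, hp⟩ := h (e.symm v)
  refine ⟨e w, (p.map e.toHom).copy (by simp) rfl, ?_⟩
  have := hp.map e.toHom e.bijective
  intro a
  simpa using this a

end Iso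

/-! ### Replacing a vertex by a triangle -/

variable {V : Type*}

/-- The adjacency relation of `SimpleGraph.expand`. -/
def expandAdj (G : SimpleGraph V) (v b c : V) : Option (Option V) → Option (Option V) → Prop
  | none, none => False
  | none, some none => True
  | some none, none => True
  | some none, some none => False
  | none, some (some u) => u = v ∨ u = b
  | some (some u), none => u = v ∨ u = b
  | some none, some (some u) => u = v ∨ u = c
  | some (some u), some none => u = v ∨ u = c
  | some (some u), some (some w) => G.Adj u w ∧ (u = v → w ≠ b ∧ w ≠ c) ∧ (w = v → u ≠ b ∧ u ≠ c)

/-- Replace the vertex `v` by a triangle: the vertex `none` takes over the edge from `v` to `b`,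
the vertex `some none` takes over the edge from `v` to `c`, and `v` keeps its other edges. -/
def expand (G : SimpleGraph V) (v b c : V) : SimpleGraph (Option (Option V)) where
  Adj := G.expandAdj v b c
  symm := ⟨by
    rintro (_ | _ | u) (_ | _ | w) h <;> simp_all [expandAdj, G.adj_comm]⟩
  loopless := ⟨by
    rintro (_ | _ | u) h <;> simp_all [expandAdj]⟩

/-- The map contracting the triangle of `SimpleGraph.expand` to `v`. -/
def contract (v : V) : Option (Option V) → V
  | none => v
  | some none => v
  | some (some u) => u

/-- The graph obtained by contracting the triangle of `SimpleGraph.expand`. -/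
def contractGraph (v : V) (H : SimpleGraph (Option (Option V))) : SimpleGraph V where
  Adj u w := u ≠ w ∧ ∃ p q, contract v p = u ∧ contract v q = w ∧ H.Adj p q
  symm := ⟨by
    rintro u w ⟨h, p, q, hp, hq, hpq⟩
    exact ⟨h.symm, q, p, hq, hp, hpq.symm⟩⟩
  loopless := ⟨fun u h => h.1 rfl⟩

section

variable {G : SimpleGraph V} {v a b c : V}

theorem adj_of_expand_adj (hb : G.Adj v b) (hc : G.Adj v c) {p q : Option (Option V)}
    (h : (G.expand v b c).Adj p q) (hpq : contract v p ≠ contract v q) :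
    G.Adj (contract v p) (contract v q) := by
  rcases p with _ | _ | u <;> rcases q with _ | _ | w <;>
    simp_all [expand, expandAdj, contract] <;> grind [SimpleGraph.Adj.symm]

/-- An outside vertex sees at most one vertex of the triangle, so contraction does not change
degrees outside it. -/
theorem injOn_contract (hbc : b ≠ c) {u : V} (hu : u ≠ v) :
    Set.InjOn (contract v) ((G.expand v b c).neighborSet (some (some u))) := by
  rintro (_ | _ | p) hp (_ | _ | q) hq hpq <;>
    simp_all [expand, expandAdj, contract]

theorem contract_image_neighborSet (hb : G.Adj v b) (hc : G.Adj v c) {u : V} (hu : u ≠ v) :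
    contract v '' (G.expand v b c).neighborSet (some (some u)) = G.neighborSet u := by
  ext w
  constructor
  · rintro ⟨p, hp, rfl⟩
    by_cases h : u = contract v p
    · rcases p with _ | _ | w <;> simp_all [expand, expandAdj, contract]
    · exact adj_of_expand_adj hb hc (p := some (some u)) hp h
  · intro hw
    rw [mem_neighborSet] at hw
    by_cases hwv : w = v
    · subst hwv
      by_cases hub : u = b
      · exact ⟨none, by simp [expand, expandAdj, hub], rfl⟩
      by_cases huc : u = c
      · exact ⟨some none, by simp [expand, expandAdj, huc], rfl⟩
      exact ⟨some (some w), by simp [expand, expandAdj, hub, huc, hu, hw], rfl⟩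
    · exact ⟨some (some w), by simp [expand, expandAdj, hwv, hu, hw], rfl⟩

theorem expand_neighborSet_none :
    (G.expand v b c).neighborSet none = {some (some v), some none, some (some b)} := by
  ext (_ | _ | u) <;> simp [expand, expandAdj]

theorem expand_neighborSet_some_none :
    (G.expand v b c).neighborSet (some none) = {some (some v), none, some (some c)} := by
  ext (_ | _ | u) <;> simp [expand, expandAdj]

theorem expand_neighborSet_base (hN : G.neighborSet v = {a, b, c}) (hab : a ≠ b) (hac : a ≠ c) :
    (G.expand v b c).neighborSet (some (some v)) = {some (some a), none, some none} := by
  have h : ∀ u, G.Adj v u ↔ u = a ∨ u = b ∨ u = c := fun u => by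
    rw [← mem_neighborSet, hN]; rfl
  have hv := G.loopless.irrefl v
  ext (_ | _ | u) <;> simp [expand, expandAdj, h]
  grind

end

end SimpleGraph

/-! ### Connected 2-factors under contraction of the triangle -/

theorem Set.ncard_triple {α : Type*} {a b c : α} (hab : a ≠ b) (hac : a ≠ c) (hbc : b ≠ c) :
    ({a, b, c} : Set α).ncard = 3 := by
  rw [Set.ncard_insert_of_notMem (by simp [hab, hac]), Set.ncard_pair hbc]

/-- A subset of a triple has two elements if it misses exactly one element of the triple. -/
theorem Set.ncard_eq_two_iff_of_subset_triple {α : Type*} {a b c : α} (hab : a ≠ b) (hac : a ≠ c)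
    (hbc : b ≠ c) {N : Set α} (hN : N ⊆ {a, b, c}) :
    N.ncard = 2 ↔ (a ∈ N ∧ b ∈ N ∧ c ∉ N) ∨ (a ∈ N ∧ b ∉ N ∧ c ∈ N) ∨
      (a ∉ N ∧ b ∈ N ∧ c ∈ N) := by
  classical
  have hN' : N = ((({a, b, c} : Finset α).filter (· ∈ N) : Finset α) : Set α) := by
    ext x
    have := @hN x
    simp at this ⊢
    tauto
  have hcard : N.ncard = (({a, b, c} : Finset α).filter (· ∈ N)).card := by
    conv_lhs => rw [hN']
    rw [Set.ncard_coe_finset]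
  rw [hcard]
  by_cases ha : a ∈ N <;> by_cases hb : b ∈ N <;> by_cases hc : c ∈ N <;>
    simp [Finset.filter_insert, Finset.filter_singleton, ha, hb, hc, hab, hac, hbc]

namespace SimpleGraph

variable {V : Type*}

section

variable {G : SimpleGraph V} {v a b c : V}

/-- The graph has no connected spanning `2`-regular subgraph. -/
def NoConnectedTwoFactor (G : SimpleGraph V) : Prop :=
  ∀ H ≤ G, (∀ v, (H.neighborSet v).ncard = 2) → ¬ H.Connected

/-- The edges of a Hamilton cycle form a connected 2-factor. Order 1 is excluded because
`IsHamiltonian` holds there by convention. -/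
theorem NoConnectedTwoFactor.not_isHamiltonian [Fintype V] [DecidableEq V]
    (h : G.NoConnectedTwoFactor) (hV : Fintype.card V ≠ 1) : ¬ G.IsHamiltonian := by
  intro hG
  obtain ⟨a, p, hp⟩ := hG hV
  refine h p.toSubgraph.spanningCoe p.toSubgraph.spanningCoe_le (fun v => ?_) ?_
  · exact hp.isCycle.ncard_neighborSet_toSubgraph_eq_two (hp.mem_support v)
  · have hs : p.toSubgraph.IsSpanning := fun v => by
      rw [Walk.mem_verts_toSubgraph]; exact hp.mem_support v
    have := p.toSubgraph_connected.coe
    exact (p.toSubgraph.spanningCoeEquivCoeOfSpanning hs).connected_iff.2 this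

/-- Parity: `p`, `q`, `r` are the triangle edges and `A`, `B`, `C` the outer edges. The three
degrees sum to 6 and count each triangle edge twice, so the number of outer edges is even; being
positive and at most 3, it is 2. -/
theorem two_of_three_of_triangle {A B C p q r : Prop}
    (h1 : (A ∧ p ∧ ¬ q) ∨ (A ∧ ¬ p ∧ q) ∨ (¬ A ∧ p ∧ q))
    (h2 : (p ∧ r ∧ ¬ B) ∨ (p ∧ ¬ r ∧ B) ∨ (¬ p ∧ r ∧ B))
    (h3 : (q ∧ r ∧ ¬ C) ∨ (q ∧ ¬ r ∧ C) ∨ (¬ q ∧ r ∧ C)) (h : A ∨ B ∨ C) :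
    (A ∧ B ∧ ¬ C) ∨ (A ∧ ¬ B ∧ C) ∨ (¬ A ∧ B ∧ C) := by
  by_cases p <;> by_cases q <;> by_cases r <;> simp_all

/-- The contraction of a connected 2-factor `H` stays connected and keeps its degrees away from `v`.
At `v` its degree is the number of outer edges of the triangle in `H`, which is 2 by parity and
connectedness. -/
theorem NoConnectedTwoFactor.expand (h : G.NoConnectedTwoFactor)
    (hN : G.neighborSet v = {a, b, c}) (hab : a ≠ b) (hac : a ≠ c) (hbc : b ≠ c) :
    (G.expand v b c).NoConnectedTwoFactor := by
  intro H hH hdeg hconn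
  have hadj : ∀ u, G.Adj v u ↔ u = a ∨ u = b ∨ u = c := fun u => by
    rw [← mem_neighborSet, hN]; rfl
  have hb : G.Adj v b := by simp [hadj]
  have hc : G.Adj v c := by simp [hadj]
  have ha : G.Adj v a := by simp [hadj]
  have hva := ha.ne
  have hvb := hb.ne
  have hvc := hc.ne
  have hsub : ∀ p, H.neighborSet p ⊆ (G.expand v b c).neighborSet p := fun p q hq => hH hq
  have h1 := (Set.ncard_eq_two_iff_of_subset_triple (by simp) (by simp) (by simp)
    (expand_neighborSet_base hN hab hac ▸ hsub (some (some v)))).1 (hdeg _)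
  have h2 := (Set.ncard_eq_two_iff_of_subset_triple (by simp) (by simpa using hvb) (by simp)
    (expand_neighborSet_none ▸ hsub none)).1 (hdeg _)
  have h3 := (Set.ncard_eq_two_iff_of_subset_triple (by simp) (by simpa using hvc) (by simp)
    (expand_neighborSet_some_none ▸ hsub (some none))).1 (hdeg _)
  simp only [mem_neighborSet] at h1 h2 h3
  rw [H.adj_comm none (some (some v))] at h2
  rw [H.adj_comm (some none) (some (some v)), H.adj_comm (some none) none] at h3
  refine h (contractGraph v H) ?_ (fun u => ?_) ?_
  · rintro u w ⟨huw, p, q, rfl, rfl, hpq⟩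
    exact adj_of_expand_adj hb hc (hH hpq) huw
  · by_cases hu : u = v
    · subst hu
      have hout : ∀ w, (contractGraph u H).Adj u w ↔ u ≠ w ∧ (H.Adj (some (some u)) (some (some w)) ∨
          H.Adj none (some (some w)) ∨ H.Adj (some none) (some (some w))) := by
        intro w
        constructor
        · rintro ⟨huw, p, q, hp, hq, hpq⟩
          refine ⟨huw, ?_⟩
          rcases p with _ | _ | p <;> rcases q with _ | _ | q <;> simp_all [contract]
        · rintro ⟨huw, h | h | h⟩
          exacts [⟨huw, _, _, rfl, rfl, h⟩, ⟨huw, _, _, rfl, rfl, h⟩, ⟨huw, _, _, rfl, rfl, h⟩]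
      rw [Set.ncard_eq_two_iff_of_subset_triple hab hac hbc]
      · have e1 : ∀ w, H.Adj (some (some u)) (some (some w)) → w = a := fun w hw => by
          have : some (some w) ∈ (G.expand u b c).neighborSet (some (some u)) := hH hw
          rw [expand_neighborSet_base hN hab hac] at this
          simpa using this
        have e2 : ∀ w, H.Adj none (some (some w)) → w = u ∨ w = b := fun w hw => hH hw
        have e3 : ∀ w, H.Adj (some none) (some (some w)) → w = u ∨ w = c := fun w hw => hH hw
        simp only [mem_neighborSet, hout]
        -- Without an outer edge in `H`, no walk of `H` could leave the triangle.
        have key : H.Adj (some (some u)) (some (some a)) ∨ H.Adj none (some (some b)) ∨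
            H.Adj (some none) (some (some c)) := by
          by_contra! hno
          obtain ⟨w⟩ := hconn.preconnected none (some (some a))
          obtain ⟨d, -, hd1, hd2⟩ := w.exists_boundary_dart
            {none, some none, some (some u)} (by simp) (by simp [hva.symm])
          have hd := d.adj
          generalize d.fst = p at *
          generalize d.snd = q at *
          rcases q with _ | _ | q
          · simp at hd2
          · simp at hd2
          · have hq : q ≠ u := by simpa using hd2
            rcases hd1 with rfl | rfl | rfl
            · rcases e2 q hd with rfl | rfl <;> tauto
            · rcases e3 q hd with rfl | rfl <;> tauto
            · rcases e1 q hd with rfl; tauto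
        have n1 : ¬ H.Adj (some (some u)) (some (some b)) := fun h => hab (e1 _ h).symm
        have n2 : ¬ H.Adj (some (some u)) (some (some c)) := fun h => hac (e1 _ h).symm
        have n3 : ¬ H.Adj none (some (some a)) := fun h => by rcases e2 _ h with h | h <;> simp_all
        have n4 : ¬ H.Adj none (some (some c)) := fun h => by rcases e2 _ h with h | h <;> simp_all
        have n5 : ¬ H.Adj (some none) (some (some a)) := fun h => by
          rcases e3 _ h with h | h <;> simp_all
        have n6 : ¬ H.Adj (some none) (some (some b)) := fun h => by
          rcases e3 _ h with h | h <;> simp_all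
        simp only [n1, n2, n3, n4, n5, n6, hva, hvb, hvc, ne_eq, not_false_eq_true, true_and,
          false_or, or_false]
        exact two_of_three_of_triangle h1 h2 h3 key
      · rintro w ⟨huw, p, q, hp, hq, hpq⟩
        have := adj_of_expand_adj hb hc (hH hpq) (by rwa [hp, hq])
        rw [hp, hq, hadj] at this
        simpa using this
    · have : (contractGraph v H).neighborSet u = contract v '' H.neighborSet (some (some u)) := by
        ext w
        constructor
        · rintro ⟨huw, p, q, hp, hq, hpq⟩
          rcases p with _ | _ | p
          · exact absurd hp.symm hu
          · exact absurd hp.symm hu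
          · rw [show p = u from hp] at hpq
            exact ⟨q, hpq, hq⟩
        · rintro ⟨q, hq, rfl⟩
          refine ⟨fun h => ?_, some (some u), q, rfl, rfl, hq⟩
          have hm : contract v q ∈ G.neighborSet u :=
            contract_image_neighborSet hb hc hu ▸ ⟨q, hH hq, rfl⟩
          rw [← h] at hm
          exact G.loopless.irrefl _ hm
      rw [this, ((injOn_contract hbc hu).mono (hsub _)).ncard_image, hdeg]
  · have hr : ∀ p q, H.Reachable p q → (contractGraph v H).Reachable (contract v p) (contract v q) := by
      rintro p q ⟨w⟩
      induction w with
      | nil => rfl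
      | @cons p r q hpr w ih =>
        by_cases h : contract v p = contract v r
        · rwa [h]
        · have hadj : (contractGraph v H).Adj (contract v p) (contract v r) :=
            ⟨h, p, r, rfl, rfl, hpr⟩
          exact hadj.reachable.trans ih
    have : Nonempty V := ⟨v⟩
    exact ⟨fun u w => hr (some (some u)) (some (some w)) (hconn.preconnected _ _)⟩

theorem expand_ncard_neighborSet (h : ∀ u, (G.neighborSet u).ncard = 3)
    (hN : G.neighborSet v = {a, b, c}) (hab : a ≠ b) (hac : a ≠ c) (hbc : b ≠ c)
    (p : Option (Option V)) : ((G.expand v b c).neighborSet p).ncard = 3 := by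
  have hadj : ∀ u, G.Adj v u ↔ u = a ∨ u = b ∨ u = c := fun u => by
    rw [← mem_neighborSet, hN]; rfl
  have hb : G.Adj v b := by simp [hadj]
  have hc : G.Adj v c := by simp [hadj]
  rcases p with _ | _ | u
  · rw [expand_neighborSet_none, Set.ncard_triple] <;> simp [hb.ne]
  · rw [expand_neighborSet_some_none, Set.ncard_triple] <;> simp [hc.ne]
  · by_cases hu : u = v
    · subst hu
      rw [expand_neighborSet_base hN hab hac, Set.ncard_triple] <;> simp
    · rw [← (injOn_contract hbc hu).ncard_image, contract_image_neighborSet hb hc hu, h]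

end

/-! ### Hamilton paths after the replacement -/

theorem PathOn.of_list {G : SimpleGraph V} (l : List V) (hne : l ≠ []) (hc : l.IsChain G.Adj)
    (hl : l.Nodup) : G.PathOn {w | w ∈ l} (l.head hne) (l.getLast hne) :=
  ⟨.ofSupport l hne hc, by simpa [Walk.isPath_def] using hl, by simp⟩

section

variable {G : SimpleGraph V} {v a b c : V}

theorem expand_pathOn {S : Set V} {u w : V} (h : G.PathOn S u w) (hv : v ∉ S) :
    (G.expand v b c).PathOn ((fun x => some (some x)) '' S) (some (some u)) (some (some w)) := by
  refine h.map (G' := G.expand v b c) (Function.Embedding.some.trans Function.Embedding.some)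
    fun x hx y hy hxy => ?_
  have hxv : x ≠ v := fun h => hv (h ▸ hx)
  have hyv : y ≠ v := fun h => hv (h ▸ hy)
  simp [expand, expandAdj, hxv, hyv, hxy]

theorem pathOn_triangle {p q r : V} (hpq : G.Adj p q) (hqr : G.Adj q r) (hpr : p ≠ r)
    {T : Set V} (hT : ∀ x, x ∈ T ↔ x = p ∨ x = q ∨ x = r) : G.PathOn T p r :=
  (((PathOn.singleton r).cons hqr (by simpa using hqr.ne)).cons hpq
    (by simp [hpq.ne, hpr])).congr fun x => by simp [hT]

/-- The vertex set of the triangle of `SimpleGraph.expand`. -/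
def triangle (v : V) : Set (Option (Option V)) :=
  {none, some none, some (some v)}

/-- This lets a path through `v` detour over the whole triangle, whichever two edges it uses at `v`.
-/
theorem expand_pathOn_triangle (hN : G.neighborSet v = {a, b, c}) (hab : a ≠ b) (hac : a ≠ c)
    {s t : V} (hs : G.Adj v s) (ht : G.Adj v t) (hst : s ≠ t) :
    ∃ p q, (G.expand v b c).Adj (some (some s)) p ∧ (G.expand v b c).Adj q (some (some t)) ∧
      (G.expand v b c).PathOn (triangle v) p q := by
  have h1 : (G.expand v b c).Adj (some (some v)) none := Or.inl rfl
  have h2 : (G.expand v b c).Adj (some (some v)) (some none) := Or.inl rfl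
  have h3 : (G.expand v b c).Adj none (some none) := trivial
  have hA : (G.expand v b c).Adj (some (some v)) (some (some a)) := by
    rw [← mem_neighborSet, expand_neighborSet_base hN hab hac]; simp
  have hB : (G.expand v b c).Adj none (some (some b)) := Or.inr rfl
  have hC : (G.expand v b c).Adj (some none) (some (some c)) := Or.inr rfl
  rw [← mem_neighborSet, hN] at hs ht
  rcases hs with rfl | rfl | rfl <;> rcases ht with rfl | rfl | rfl <;> try exact absurd rfl hst
  · exact ⟨_, _, hA.symm, hB, pathOn_triangle h2 h3.symm (by simp) (by simp [triangle]; grind)⟩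
  · exact ⟨_, _, hA.symm, hC, pathOn_triangle h1 h3 (by simp) (by simp [triangle]; grind)⟩
  · exact ⟨_, _, hB.symm, hA, pathOn_triangle h3 h2.symm (by simp) (by simp [triangle])⟩
  · exact ⟨_, _, hB.symm, hC, pathOn_triangle h1.symm h2 (by simp) (by simp [triangle]; grind)⟩
  · exact ⟨_, _, hC.symm, hA, pathOn_triangle h3.symm h1.symm (by simp) (by simp [triangle]; grind)⟩
  · exact ⟨_, _, hC.symm, hB, pathOn_triangle h2.symm h1 (by simp) (by simp [triangle]; grind)⟩

theorem disjoint_triangle {S : Set V} (hv : v ∉ S) :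
    Disjoint (triangle v) ((fun x => some (some x)) '' S) := by
  simp [triangle, hv]

/-- A homogeneously traceable cubic graph without a connected `2`-factor, with Hamilton paths that
start at some vertex `v` with two different edges. -/
def IsCubicSeed (G : SimpleGraph V) : Prop :=
  (∀ u, (G.neighborSet u).ncard = 3) ∧ (∀ u, ∃ w, G.PathOn Set.univ u w) ∧
    G.NoConnectedTwoFactor ∧ ∃ v a b c, a ≠ b ∧ a ≠ c ∧ b ≠ c ∧ G.neighborSet v = {a, b, c} ∧
      (∃ w, G.PathOn {v}ᶜ b w) ∧ ∃ w, G.PathOn {v}ᶜ c w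

/-- A path starting outside the triangle comes from one of `G`, with `v` blown up to the triangle.
From a triangle vertex, the triangle is traversed first, leaving by the edge to `b` or `c`; this is
where `hb` and `hc` are needed. -/
theorem expand_exists_pathOn_univ (h : ∀ u, ∃ w, G.PathOn Set.univ u w)
    (hN : G.neighborSet v = {a, b, c}) (hab : a ≠ b) (hac : a ≠ c)
    (hb : ∃ w, G.PathOn {v}ᶜ b w) (hc : ∃ w, G.PathOn {v}ᶜ c w) (p : Option (Option V)) :
    ∃ q, (G.expand v b c).PathOn Set.univ p q := by
  have h1 : (G.expand v b c).Adj (some (some v)) none := Or.inl rfl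
  have h2 : (G.expand v b c).Adj (some (some v)) (some none) := Or.inl rfl
  have h3 : (G.expand v b c).Adj none (some none) := trivial
  have hB : (G.expand v b c).Adj none (some (some b)) := Or.inr rfl
  have hC : (G.expand v b c).Adj (some none) (some (some c)) := Or.inr rfl
  have huniv : ∀ x, x ∈ triangle v ∪ (fun x => some (some x)) '' {v}ᶜ ↔ x ∈ Set.univ := by
    rintro (_ | _ | x)
    · simp [triangle]
    · simp [triangle]
    · simp [triangle, em]
  obtain ⟨wb, hb⟩ := hb
  obtain ⟨wc, hc⟩ := hc
  have hb' := expand_pathOn (v := v) (b := b) (c := c) hb (by simp)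
  have hc' := expand_pathOn (v := v) (b := b) (c := c) hc (by simp)
  have hdis := disjoint_triangle (v := v) (S := {v}ᶜ) (by simp)
  rcases p with _ | _ | u
  · exact ⟨_, ((pathOn_triangle h1.symm h2 (by simp) (by simp [triangle]; grind)).append hC hc'
      hdis).congr huniv⟩
  · exact ⟨_, ((pathOn_triangle h2.symm h1 (by simp) (by simp [triangle]; grind)).append hB hb'
      hdis).congr huniv⟩
  by_cases hu : u = v
  · subst hu
    exact ⟨_, ((pathOn_triangle h1 h3 (by simp) (by simp [triangle]; grind)).append hC hc'
      hdis).congr huniv⟩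
  obtain ⟨w, hw⟩ := h u
  obtain ⟨s, A, hA, hsv, hvA, hsplit⟩ := hw.split (Set.mem_univ v) hu
  have hA' := expand_pathOn (v := v) (b := b) (c := c) hA hvA
  rcases hsplit with hsplit | ⟨t, B, hB', hvt, hvB, hAB, hsplit⟩
  -- The old path ends at `v`, so any second neighbor `t` will do: it only selects a traversal of
  -- the triangle, and the edge towards it is not used.
  · obtain ⟨t, hvt, hst⟩ : ∃ t, G.Adj v t ∧ s ≠ t := by
      have hmem : ∀ x ∈ ({a, b, c} : Set V), G.Adj v x := fun x hx => by
        rwa [← hN] at hx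
      by_cases hsa : s = a
      · exact ⟨b, hmem b (by simp), by rwa [hsa]⟩
      · exact ⟨a, hmem a (by simp), hsa⟩
    obtain ⟨p, q, hp, -, hT⟩ := expand_pathOn_triangle hN hab hac hsv.symm hvt hst
    refine ⟨q, (hA'.append hp hT (disjoint_triangle hvA).symm).congr fun x => ?_⟩
    have h0 : A = {v}ᶜ := by
      ext y
      have := hsplit y
      simp only [Set.mem_univ, true_iff] at this
      simp only [Set.mem_compl_iff, Set.mem_singleton_iff]
      constructor
      · rintro hy rfl; exact hvA hy
      · exact this.resolve_left
    rw [Set.union_comm, h0, huniv]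
  · have hst : s ≠ t := by
      rintro rfl
      obtain ⟨p, -, hp⟩ := hA
      obtain ⟨q, -, hq⟩ := hB'
      exact Set.disjoint_left.1 hAB ((hp s).1 p.end_mem_support) ((hq s).1 q.start_mem_support)
    obtain ⟨p, q, hp, hq, hT⟩ := expand_pathOn_triangle hN hab hac hsv.symm hvt hst
    have hBB := expand_pathOn (v := v) (b := b) (c := c) hB' hvB
    refine ⟨_, ((hA'.append hp hT (disjoint_triangle hvA).symm).append hq hBB ?_).congr
      fun x => ?_⟩
    · rw [Set.disjoint_union_left]
      refine ⟨?_, disjoint_triangle hvB⟩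
      rw [Set.disjoint_image_iff]
      · exact hAB
      · intro x y hxy
        simpa using hxy
    · have h0 : A ∪ B = {v}ᶜ := by
        ext y
        have := hsplit y
        simp only [Set.mem_univ, true_iff] at this
        simp only [Set.mem_compl_iff, Set.mem_singleton_iff, Set.mem_union]
        constructor
        · rintro (hy | hy) rfl
          exacts [hvA hy, hvB hy]
        · exact this.resolve_left
      rw [← huniv x, ← h0, Set.image_union]
      simp only [Set.mem_union]
      tauto

/-- The new distinguished vertex is the triangle vertex that keeps the name `v`. Either of its two
triangle edges starts a Hamilton path: the other two triangle vertices are visited in one order or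
the other, and then an old path from `c` or `b` is followed. -/
theorem IsCubicSeed.exists_expand (h : G.IsCubicSeed) :
    ∃ v b c, (G.expand v b c).IsCubicSeed := by
  obtain ⟨hdeg, hpath, htwo, v, a, b, c, hab, hac, hbc, hN, hb, hc⟩ := h
  refine ⟨v, b, c, expand_ncard_neighborSet hdeg hN hab hac hbc,
    expand_exists_pathOn_univ hpath hN hab hac hb hc, htwo.expand hN hab hac hbc,
    some (some v), some (some a), none, some none, by simp, by simp, by simp,
    expand_neighborSet_base hN hab hac, ?_, ?_⟩
  · obtain ⟨w, hc⟩ := hc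
    have hc' := expand_pathOn (v := v) (b := b) (c := c) hc (by simp)
    have h3 : (G.expand v b c).Adj none (some none) := trivial
    have hC : (G.expand v b c).Adj (some none) (some (some c)) := Or.inr rfl
    refine ⟨_, ((hc'.cons hC (by simp)).cons h3 (by simp)).congr ?_⟩
    rintro (_ | _ | x) <;> simp
  · obtain ⟨w, hb⟩ := hb
    have hb' := expand_pathOn (v := v) (b := b) (c := c) hb (by simp)
    have h3 : (G.expand v b c).Adj (some none) none := trivial
    have hB : (G.expand v b c).Adj none (some (some b)) := Or.inr rfl
    refine ⟨_, ((hb'.cons hB (by simp)).cons h3 (by simp)).congr ?_⟩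
    rintro (_ | _ | x) <;> simp

end

/-! ### The Petersen graph as initial seed -/

/-- The `k`-th neighbor of a vertex of the Petersen graph. -/
def petersenNeighbor : Fin 3 → Fin 10 → Fin 10 :=
  ![![1, 2, 3, 4, 0, 7, 8, 9, 5, 6],
    ![4, 0, 1, 2, 3, 8, 9, 5, 6, 7],
    ![5, 6, 7, 8, 9, 0, 1, 2, 3, 4]]

/-- The Petersen graph. -/
def petersen : SimpleGraph (Fin 10) where
  Adj u w := w = petersenNeighbor 0 u ∨ w = petersenNeighbor 1 u ∨ w = petersenNeighbor 2 u
  symm := ⟨by decide⟩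
  loopless := ⟨by decide⟩

instance : DecidableRel petersen.Adj := fun u w =>
  inferInstanceAs (Decidable (w = petersenNeighbor 0 u ∨ w = petersenNeighbor 1 u ∨
    w = petersenNeighbor 2 u))

theorem petersen_neighborSet (u : Fin 10) : petersen.neighborSet u =
    {petersenNeighbor 0 u, petersenNeighbor 1 u, petersenNeighbor 2 u} := rfl

theorem petersenNeighbor_ne : ∀ u, petersenNeighbor 0 u ≠ petersenNeighbor 1 u ∧
    petersenNeighbor 0 u ≠ petersenNeighbor 2 u ∧ petersenNeighbor 1 u ≠ petersenNeighbor 2 u := by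
  decide

/-- A Hamilton path of the Petersen graph starting at a given vertex. -/
def petersenPath : Fin 10 → List (Fin 10) :=
  ![[0, 1, 2, 3, 4, 9, 6, 8, 5, 7],
    [1, 2, 3, 4, 0, 5, 7, 9, 6, 8],
    [2, 3, 4, 0, 1, 6, 8, 5, 7, 9],
    [3, 4, 0, 1, 2, 7, 9, 6, 8, 5],
    [4, 0, 1, 2, 3, 8, 5, 7, 9, 6],
    [5, 7, 9, 6, 8, 3, 4, 0, 1, 2],
    [6, 8, 5, 7, 9, 4, 0, 1, 2, 3],
    [7, 9, 6, 8, 5, 0, 1, 2, 3, 4],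
    [8, 5, 7, 9, 6, 1, 2, 3, 4, 0],
    [9, 6, 8, 5, 7, 2, 3, 4, 0, 1]]

/-- Exactly two of three Booleans are true. -/
def twoOfThree (x y z : Bool) : Bool :=
  (x && y && !z) || (x && !y && z) || (!x && y && z)

set_option maxRecDepth 100000 in
set_option synthInstance.maxSize 5000 in
set_option synthInstance.maxHeartbeats 400000 in
/-- Every `2`-factor of the Petersen graph has no edge across one of six cuts. -/
theorem petersen_two_factor_cut :
    ∀ e01 e04 e05 : Bool, twoOfThree e01 e04 e05 →
    ∀ e12 e16 : Bool, twoOfThree e12 e01 e16 →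
    ∀ e23 e27 : Bool, twoOfThree e23 e12 e27 →
    ∀ e34 e38 : Bool, twoOfThree e34 e23 e38 →
    ∀ e49 : Bool, twoOfThree e04 e34 e49 →
    ∀ e57 e58 : Bool, twoOfThree e57 e58 e05 →
    ∀ e68 e69 : Bool, twoOfThree e68 e69 e16 →
    ∀ e79 : Bool, twoOfThree e79 e57 e27 →
    twoOfThree e58 e68 e38 →
    twoOfThree e69 e79 e49 →
    (e05 || e16 || e27 || e38 || e49) →
    (e05 || e12 || e34 || e68 || e79) →
    (e04 || e16 || e23 || e58 || e79) →
    (e01 || e27 || e34 || e69 || e58) →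
    (e12 || e38 || e04 || e57 || e69) →
    (e01 || e23 || e49 || e57 || e68) →
    False := by
  -- Each degree condition follows directly after the edges it involves are introduced, so the
  -- evaluation prunes early instead of running through all `2 ^ 15` edge sets.
  decide

/-- The complement of a 2-factor is one of the six perfect matchings, and each of these is the full
edge cut between two 5-cycles. A connected `H` would have to meet all six cuts. -/
theorem petersen_noConnectedTwoFactor : petersen.NoConnectedTwoFactor := by
  classical
  intro H hH hdeg hconn
  have htwo (u : Fin 10) : twoOfThree (H.Adj u (petersenNeighbor 0 u))
      (H.Adj u (petersenNeighbor 1 u)) (H.Adj u (petersenNeighbor 2 u)) := by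
    obtain ⟨h1, h2, h3⟩ := petersenNeighbor_ne u
    have := (Set.ncard_eq_two_iff_of_subset_triple h1 h2 h3
      (show H.neighborSet u ⊆ _ from fun w hw =>
        (hH hw : w ∈ petersen.neighborSet u))).1 (hdeg u)
    simp only [mem_neighborSet] at this
    simpa [twoOfThree, and_assoc, or_assoc] using this
  have hcut (S : Finset (Fin 10)) (h0 : S.Nonempty) (h1 : Sᶜ.Nonempty) :
      ∃ u ∈ S, ∃ k, petersenNeighbor k u ∉ S ∧ H.Adj u (petersenNeighbor k u) := by
    obtain ⟨x, hx⟩ := h0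
    obtain ⟨y, hy⟩ := h1
    obtain ⟨p⟩ := hconn.preconnected x y
    obtain ⟨d, -, hd1, hd2⟩ := p.exists_boundary_dart S hx (by simpa using hy)
    have hd := d.adj
    rcases hH hd with h | h | h <;> exact ⟨_, hd1, _, h ▸ hd2, h ▸ hd⟩
  have h0 := htwo 0
  have h1 := htwo 1
  have h2 := htwo 2
  have h3 := htwo 3
  have h4 := htwo 4
  have h5 := htwo 5
  have h6 := htwo 6
  have h7 := htwo 7
  have h8 := htwo 8
  have h9 := htwo 9
  -- For each perfect matching, the set is one of the two 5-cycles that remain after its removal.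
  have c0 := hcut {0, 1, 2, 3, 4} (by simp) (by decide)
  have c1 := hcut {0, 1, 4, 6, 9} (by simp) (by decide)
  have c2 := hcut {0, 1, 2, 5, 7} (by simp) (by decide)
  have c3 := hcut {1, 2, 3, 6, 8} (by simp) (by decide)
  have c4 := hcut {2, 3, 4, 7, 9} (by simp) (by decide)
  have c5 := hcut {0, 3, 4, 5, 8} (by simp) (by decide)
  simp [petersenNeighbor, Fin.exists_fin_succ,
    H.adj_comm 1 0, H.adj_comm 4 0, H.adj_comm 5 0, H.adj_comm 2 1, H.adj_comm 6 1, H.adj_comm 3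
    2, H.adj_comm 7 2, H.adj_comm 4 3, H.adj_comm 8 3, H.adj_comm 9 4, H.adj_comm 7 5,
    H.adj_comm 8 5, H.adj_comm 8 6, H.adj_comm 9 6, H.adj_comm 9 7]
    at h0 h1 h2 h3 h4 h5 h6 h7 h8 h9 c0 c1 c2 c3 c4 c5
  exact petersen_two_factor_cut (H.Adj 0 1) (H.Adj 0 4) (H.Adj 0 5) h0 (H.Adj 1 2) (H.Adj 1 6)
    h1 (H.Adj 2 3) (H.Adj 2 7) h2 (H.Adj 3 4) (H.Adj 3 8) h3 (H.Adj 4 9) h4 (H.Adj 5 7) (H.Adj 5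
    8) h5 (H.Adj 6 8) (H.Adj 6 9) h6 (H.Adj 7 9) h7 h8 h9 (by simpa [or_assoc] using c0)
    (by simpa [or_assoc] using c1) (by simpa [or_assoc] using c2) (by simpa [or_assoc] using c3)
    (by simpa [or_assoc] using c4) (by simpa [or_assoc] using c5)

theorem petersen_isCubicSeed : petersen.IsCubicSeed := by
  refine ⟨fun u => ?_, fun u => ?_, petersen_noConnectedTwoFactor, 0, 1, 4, 5, by decide, by decide,
    by decide, rfl, ⟨_, (PathOn.of_list [4, 3, 2, 1, 6, 8, 5, 7, 9] (by simp) (by decide)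
      (by decide)).congr ?_⟩, ⟨_, (PathOn.of_list [5, 7, 9, 4, 3, 2, 1, 6, 8] (by simp) (by decide)
      (by decide)).congr ?_⟩⟩
  · obtain ⟨h1, h2, h3⟩ := petersenNeighbor_ne u
    rw [petersen_neighborSet, Set.ncard_triple h1 h2 h3]
  · have hne : petersenPath u ≠ [] := by revert u; decide
    have hhead : (petersenPath u).head hne = u := by revert u; decide
    have h := PathOn.of_list (G := petersen) (petersenPath u) hne (by revert u; decide)
      (by revert u; decide)
    rw [hhead] at h
    refine ⟨_, h.congr fun w => ?_⟩
    have : ∀ u w, w ∈ petersenPath u := by decide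
    simpa using this u w
  · simp only [Set.mem_ofPred_eq, Set.mem_compl_iff, Set.mem_singleton_iff]
    decide
  · simp only [Set.mem_ofPred_eq, Set.mem_compl_iff, Set.mem_singleton_iff]
    decide

/-! ### The cubic family, and transport along isomorphisms -/

theorem exists_isCubicSeed (k : ℕ) : ∃ (V : Type) (_ : Fintype V) (G : SimpleGraph V),
    Fintype.card V = 10 + 2 * k ∧ G.IsCubicSeed := by
  induction k with
  | zero => exact ⟨Fin 10, inferInstance, petersen, by simp, petersen_isCubicSeed⟩
  | succ k ih =>
    obtain ⟨V, _, G, hV, hG⟩ := ih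
    obtain ⟨v, b, c, h⟩ := hG.exists_expand
    exact ⟨Option (Option V), inferInstance, _, by simp [hV]; ring, h⟩

/-- Transport of a graph to the vertex set `Fin n`. -/
theorem exists_iso_fin {V : Type*} [Fintype V] (G : SimpleGraph V) {n : ℕ}
    (h : Fintype.card V = n) : ∃ G' : SimpleGraph (Fin n), Nonempty (G ≃g G') :=
  ⟨_, ⟨Iso.map (Fintype.equivFinOfCardEq h) G⟩⟩

theorem Iso.isRegularOfDegree {V W : Type*} {G : SimpleGraph V} {G' : SimpleGraph W}
    [G'.LocallyFinite] (e : G ≃g G') {d : ℕ}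
    (h : ∀ v, (G.neighborSet v).ncard = d) : G'.IsRegularOfDegree d := by
  intro w
  have h1 : (G'.neighborSet w) = e '' G.neighborSet (e.symm w) := by
    ext x
    constructor
    · intro hx
      refine ⟨e.symm x, ?_, by simp⟩
      rw [mem_neighborSet] at hx ⊢
      exact e.symm.map_adj_iff.2 hx
    · rintro ⟨y, hy, rfl⟩
      rw [mem_neighborSet] at hy ⊢
      simpa using e.map_adj_iff.2 hy
  rw [← card_neighborSet_eq_degree, ← Nat.card_eq_fintype_card, Nat.card_coe_set_eq, h1,
    Set.ncard_image_of_injective _ e.injective, h]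

theorem Iso.cycleLengths_subset {V W : Type*} {G : SimpleGraph V} {G' : SimpleGraph W}
    (e : G ≃g G') : G.cycleLengths ⊆ G'.cycleLengths := by
  rintro k ⟨v, p, hp, rfl⟩
  exact ⟨_, p.map e.toHom, hp.map e.injective, by simp⟩

theorem Iso.circumference_eq {V W : Type*} [Finite V] [Finite W] {G : SimpleGraph V}
    {G' : SimpleGraph W} (e : G ≃g G') : G'.circumference = G.circumference := by
  rw [circumference, circumference, e.cycleLengths_subset.antisymm e.symm.cycleLengths_subset]

theorem Iso.isHamiltonian {V W : Type*} [Fintype V] [Fintype W] [DecidableEq V] [DecidableEq W]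
    {G : SimpleGraph V} {G' : SimpleGraph W} (e : G ≃g G') (h : G.IsHamiltonian) :
    G'.IsHamiltonian := by
  intro hW
  obtain ⟨a, p, hp⟩ := h (by rwa [Fintype.card_congr e.toEquiv])
  exact ⟨_, p.map e.toHom, hp.map e.bijective⟩

theorem exists_cubic (n : ℕ) (hn : Even n) (h10 : 10 ≤ n) :
    ∃ (G : SimpleGraph (Fin n)) (_ : DecidableRel G.Adj),
      G.IsRegularOfDegree 3 ∧ G.HomogeneouslyTraceable ∧ ¬ G.IsHamiltonian := by
  classical
  obtain ⟨k, rfl⟩ : ∃ k, n = 10 + 2 * k := by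
    obtain ⟨r, rfl⟩ := hn
    exact ⟨r - 5, by omega⟩
  obtain ⟨V, _, G, hV, hdeg, hpath, htwo, -⟩ := exists_isCubicSeed k
  obtain ⟨G', ⟨e⟩⟩ := G.exists_iso_fin hV
  refine ⟨G', Classical.decRel _, e.isRegularOfDegree hdeg,
    e.homogeneouslyTraceable (homogeneouslyTraceable_of_pathOn hpath), fun h => ?_⟩
  exact htwo.not_isHamiltonian (by omega) (e.symm.isHamiltonian h)

/-! ### The 4-regular graph with three arms -/

/-- The vertices `x` and `y` cut the cycle into two arcs that share only their ends, so one arc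
avoids `b`; this arc leaves `I` somewhere. -/
theorem Walk.IsCycle.exists_adj_of_avoid {V : Type*} {G : SimpleGraph V} {z : V} {p : G.Walk z z}
    (hp : p.IsCycle) {x y b : V} (hx : x ∈ p.support) (hy : y ∈ p.support) (hbx : b ≠ x)
    (hby : b ≠ y) (I : Set V) (hxI : x ∈ I) (hyI : y ∉ I) :
    ∃ u ∈ I, ∃ w ∉ I, u ≠ b ∧ w ≠ b ∧ p.toSubgraph.Adj u w := by
  classical
  rw [← p.toSubgraph_rotate hx]
  have hq := (Walk.isCycle_rotate hx).2 hp
  have hy' : y ∈ (p.rotate x hx).support := by rwa [Walk.mem_support_rotate_iff]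
  obtain ⟨t, d, htd⟩ := Walk.mem_support_iff_exists_append.1 hy'
  rw [htd] at hq ⊢
  have hdart : ∀ {u v : V} (r : G.Walk u v), u ∈ I → v ∉ I → b ∉ r.support →
      ∃ u ∈ I, ∃ w ∉ I, u ≠ b ∧ w ≠ b ∧ r.toSubgraph.Adj u w := by
    intro u v r hu hv hb
    obtain ⟨e, he, he1, he2⟩ := r.exists_boundary_dart I hu hv
    refine ⟨_, he1, _, he2, fun h => hb (h ▸ r.dart_fst_mem_support_of_mem_darts he),
      fun h => hb (h ▸ r.dart_snd_mem_support_of_mem_darts he), ?_⟩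
    rw [Walk.adj_toSubgraph_iff_mem_edges]
    exact List.mem_map.2 ⟨e, he, rfl⟩
  rw [Walk.toSubgraph_append]
  by_cases hbt : b ∈ t.support
  · have hbd : b ∉ d.reverse.support := by
      intro hbd
      rw [Walk.support_reverse, List.mem_reverse] at hbd
      have hnd := hq.support_nodup
      rw [Walk.tail_support_append, List.nodup_append] at hnd
      rw [Walk.mem_support_iff] at hbt hbd
      exact hnd.2.2 b (hbt.resolve_left hbx) b (hbd.resolve_left hby) rfl
    obtain ⟨u, hu, w, hw, hub, hwb, h⟩ := hdart d.reverse hxI hyI hbd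
    rw [Walk.toSubgraph_reverse] at h
    exact ⟨u, hu, w, hw, hub, hwb, Or.inr h⟩
  · obtain ⟨u, hu, w, hw, hub, hwb, h⟩ := hdart t hxI hyI hbt
    exact ⟨u, hu, w, hw, hub, hwb, Or.inl h⟩

theorem ncard_quadruple {α : Type*} {a b c d : α} (hab : a ≠ b) (hac : a ≠ c) (had : a ≠ d)
    (hbc : b ≠ c) (hbd : b ≠ d) (hcd : c ≠ d) : ({a, b, c, d} : Set α).ncard = 4 := by
  rw [Set.ncard_insert_of_notMem (by simp [hab, hac, had]), Set.ncard_triple hbc hbd hcd]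

/-- The vertices of three arms, where the `i`-th arm consists of `ℓ i + 1` vertices. -/
abbrev ArmVertex (ℓ : Fin 3 → ℕ) : Type := (i : Fin 3) × Fin (ℓ i + 1)

/-- Adjacency in an arm with the vertices `0, …, L`: the square of a path and the edge joining the
second vertex to the last but one. -/
def armAdj (L a b : ℕ) : Prop :=
  a + 1 = b ∨ a + 2 = b ∨ b + 1 = a ∨ b + 2 = a ∨ (a = 1 ∧ b + 1 = L) ∨ (b = 1 ∧ a + 1 = L)

/-- The graph consisting of three arms whose first vertices form a triangle and whose last
vertices form a triangle. -/
def armGraph (ℓ : Fin 3 → ℕ) (hℓ : ∀ i, 5 ≤ ℓ i) : SimpleGraph (ArmVertex ℓ) where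
  Adj x y := (x.1 = y.1 ∧ armAdj (ℓ x.1) x.2 y.2) ∨
    (x.1 ≠ y.1 ∧ (((x.2 : ℕ) = 0 ∧ (y.2 : ℕ) = 0) ∨ ((x.2 : ℕ) = ℓ x.1 ∧ (y.2 : ℕ) = ℓ y.1)))
  symm := ⟨by
    rintro ⟨i, a⟩ ⟨j, b⟩ (⟨h, h'⟩ | ⟨h, h'⟩)
    · obtain rfl : i = j := h
      simp only [armAdj] at h' ⊢
      left
      refine ⟨trivial, ?_⟩
      omega
    · right
      refine ⟨h.symm, ?_⟩
      tauto⟩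
  loopless := ⟨by
    rintro ⟨i, a⟩ (⟨-, h⟩ | ⟨h, -⟩)
    · have := hℓ i
      simp only [armAdj] at h
      omega
    · exact h rfl⟩

section

variable {ℓ : Fin 3 → ℕ} {hℓ : ∀ i, 5 ≤ ℓ i}

/-- The vertex number `a` of the arm `i`. -/
def armVertex (i : Fin 3) (a : ℕ) (h : a ≤ ℓ i) : ArmVertex ℓ := ⟨i, ⟨a, Nat.lt_succ_of_le h⟩⟩

theorem armVertex_inj {i j : Fin 3} {a b : ℕ} {ha : a ≤ ℓ i} {hb : b ≤ ℓ j} :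
    armVertex i a ha = armVertex j b hb ↔ i = j ∧ a = b := by
  constructor
  · intro h
    obtain rfl : i = j := congrArg Sigma.fst h
    simpa [armVertex] using h
  · rintro ⟨rfl, rfl⟩
    rfl

theorem exists_eq_armVertex (x : ArmVertex ℓ) : ∃ i a, ∃ h : a ≤ ℓ i, x = armVertex i a h :=
  ⟨x.1, x.2, Nat.le_of_lt_succ x.2.2, rfl⟩

theorem armGraph_adj {i j : Fin 3} {a b : ℕ} {ha : a ≤ ℓ i} {hb : b ≤ ℓ j} :
    (armGraph ℓ hℓ).Adj (armVertex i a ha) (armVertex j b hb) ↔ (i = j ∧ armAdj (ℓ i) a b) ∨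
      (i ≠ j ∧ ((a = 0 ∧ b = 0) ∨ (a = ℓ i ∧ b = ℓ j))) := Iff.rfl

theorem fin_three_ne_iff : ∀ i j : Fin 3, i ≠ j ↔ j = i + 1 ∨ j = i + 2 := by decide

/-- In the square of a path only the two vertices at either end have degree below 4. The end
triangles give the extreme vertices their two missing edges, and the extra edge serves vertices 1
and `ℓ i - 1`. The bound `5 ≤ ℓ i` makes that edge new: `3 < ℓ i - 1`. -/
theorem armGraph_ncard_neighborSet (x : ArmVertex ℓ) :
    ((armGraph ℓ hℓ).neighborSet x).ncard = 4 := by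
  obtain ⟨i, a, ha, rfl⟩ := exists_eq_armVertex x
  have hL := hℓ i
  have i1 : i ≠ i + 1 := by clear * -; revert i; decide
  have i2 : i ≠ i + 2 := by clear * -; revert i; decide
  have i3 : i + 1 ≠ i + 2 := by clear * -; revert i; decide
  by_cases ha0 : a = 0
  · have : (armGraph ℓ hℓ).neighborSet (armVertex i a ha) =
        {armVertex i 1 (by omega), armVertex i 2 (by omega), armVertex (i + 1) 0 (by omega),
          armVertex (i + 2) 0 (by omega)} := by
      ext y
      obtain ⟨j, b, hb, rfl⟩ := exists_eq_armVertex y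
      simp only [mem_neighborSet, armGraph_adj, armAdj, Set.mem_insert_iff, Set.mem_singleton_iff,
        armVertex_inj, fin_three_ne_iff i j]
      grind
    rw [this, ncard_quadruple] <;> simp [armVertex_inj, i1, i2, i3]
  by_cases haL : a = ℓ i
  · have : (armGraph ℓ hℓ).neighborSet (armVertex i a ha) =
        {armVertex i (ℓ i - 1) (by omega), armVertex i (ℓ i - 2) (by omega),
          armVertex (i + 1) (ℓ (i + 1)) le_rfl, armVertex (i + 2) (ℓ (i + 2)) le_rfl} := by
      ext y
      obtain ⟨j, b, hb, rfl⟩ := exists_eq_armVertex y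
      simp only [mem_neighborSet, armGraph_adj, armAdj, Set.mem_insert_iff, Set.mem_singleton_iff,
        armVertex_inj, fin_three_ne_iff i j]
      grind
    rw [this, ncard_quadruple] <;> simp [armVertex_inj, i1, i2, i3]
    omega
  have hsame {b : ℕ} {j : Fin 3} (hb : b ≤ ℓ j) :
      (armGraph ℓ hℓ).Adj (armVertex i a ha) (armVertex j b hb) ↔ j = i ∧ armAdj (ℓ i) a b := by
    rw [armGraph_adj]
    simp [ha0, haL, eq_comm]
  by_cases ha1 : a = 1
  · have : (armGraph ℓ hℓ).neighborSet (armVertex i a ha) =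
        {armVertex i 0 (by omega), armVertex i 2 (by omega), armVertex i 3 (by omega),
          armVertex i (ℓ i - 1) (by omega)} := by
      ext y
      obtain ⟨j, b, hb, rfl⟩ := exists_eq_armVertex y
      simp only [mem_neighborSet, hsame, armAdj, Set.mem_insert_iff, Set.mem_singleton_iff,
        armVertex_inj, ← and_or_left]
      refine and_congr_right fun hj => ?_
      subst hj
      omega
    rw [this, ncard_quadruple] <;> simp [armVertex_inj] <;> omega
  by_cases haL1 : a = ℓ i - 1
  · have : (armGraph ℓ hℓ).neighborSet (armVertex i a ha) =
        {armVertex i (ℓ i) (by omega), armVertex i (ℓ i - 2) (by omega),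
          armVertex i (ℓ i - 3) (by omega), armVertex i 1 (by omega)} := by
      ext y
      obtain ⟨j, b, hb, rfl⟩ := exists_eq_armVertex y
      simp only [mem_neighborSet, hsame, armAdj, Set.mem_insert_iff, Set.mem_singleton_iff,
        armVertex_inj, ← and_or_left]
      refine and_congr_right fun hj => ?_
      subst hj
      omega
    rw [this, ncard_quadruple] <;> simp [armVertex_inj] <;> omega
  · have : (armGraph ℓ hℓ).neighborSet (armVertex i a ha) =
        {armVertex i (a - 2) (by omega), armVertex i (a - 1) (by omega),
          armVertex i (a + 1) (by omega), armVertex i (a + 2) (by omega)} := by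
      ext y
      obtain ⟨j, b, hb, rfl⟩ := exists_eq_armVertex y
      simp only [mem_neighborSet, hsame, armAdj, Set.mem_insert_iff, Set.mem_singleton_iff,
        armVertex_inj, ← and_or_left]
      refine and_congr_right fun hj => ?_
      subst hj
      omega
    rw [this, ncard_quadruple] <;> simp [armVertex_inj] <;> omega

/-! ### Hamilton paths through the arms -/

/-- The vertices number `a` to `b` of the arm `i`. -/
def armSegment (ℓ : Fin 3 → ℕ) (i : Fin 3) (a b : ℕ) : Set (ArmVertex ℓ) :=
  {x | x.1 = i ∧ a ≤ x.2 ∧ (x.2 : ℕ) ≤ b}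

theorem armVertex_mem_armSegment {i j : Fin 3} {a b c : ℕ} {hc : c ≤ ℓ j} :
    armVertex j c hc ∈ armSegment ℓ i a b ↔ j = i ∧ a ≤ c ∧ c ≤ b := Iff.rfl

theorem disjoint_armSegment {i j : Fin 3} (hij : i ≠ j) (a b c d : ℕ) :
    Disjoint (armSegment ℓ i a b) (armSegment ℓ j c d) :=
  Set.disjoint_left.2 fun _ h h' => hij (h.1.symm.trans h'.1)

theorem disjoint_armSegment_of_lt (i j : Fin 3) {a b c d : ℕ} (h : b < c) :
    Disjoint (armSegment ℓ i a b) (armSegment ℓ j c d) :=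
  Set.disjoint_left.2 fun _ h1 h2 => by
    have := h1.2.2
    have := h2.2.1
    omega

theorem pathOn_armSegment (i : Fin 3) {a b : ℕ} (hab : a ≤ b) (hb : b ≤ ℓ i) :
    (armGraph ℓ hℓ).PathOn (armSegment ℓ i a b) (armVertex i a (hab.trans hb))
      (armVertex i b hb) := by
  induction b, hab using Nat.le_induction with
  | base =>
    refine (PathOn.singleton _).congr fun y => ?_
    obtain ⟨j, b, hb, rfl⟩ := exists_eq_armVertex y
    rw [Set.mem_singleton_iff, armVertex_inj, armVertex_mem_armSegment, le_antisymm_iff (a := b),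
      and_comm (a := b ≤ a)]
  | succ b hab ih =>
    refine ((ih (by omega)).append (w := armVertex i (b + 1) hb) ?_ (PathOn.singleton _) ?_).congr
      fun y => ?_
    · exact armGraph_adj.2 (.inl ⟨rfl, .inl rfl⟩)
    · rw [Set.disjoint_singleton_right, armVertex_mem_armSegment]
      omega
    · obtain ⟨j, c, hc, rfl⟩ := exists_eq_armVertex y
      simp only [Set.mem_union, armVertex_mem_armSegment, Set.mem_singleton_iff, armVertex_inj,
        ← and_or_left]
      refine and_congr_right fun _ => ?_
      omega

/-- Descend by steps of two in one parity class and return in the other, changing class on the edge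
between 0 and 1. -/
theorem pathOn_armSegment_turn (i : Fin 3) {a : ℕ} (ha : a + 1 ≤ ℓ i) :
    (armGraph ℓ hℓ).PathOn (armSegment ℓ i 0 (a + 1)) (armVertex i (a + 1) ha)
      (armVertex i a (by omega)) := by
  induction a with
  | zero => exact (pathOn_armSegment i (by omega) ha).symm
  | succ a ih =>
    refine ((ih (by omega)).symm.cons (u := armVertex i (a + 2) ha) ?_ ?_).congr fun y => ?_
    · exact armGraph_adj.2 (.inl ⟨rfl, by simp [armAdj]⟩)
    · rw [armVertex_mem_armSegment]
      omega
    · obtain ⟨j, c, hc, rfl⟩ := exists_eq_armVertex y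
      simp only [Set.mem_insert_iff, armVertex_mem_armSegment, armVertex_inj, ← and_or_left]
      refine and_congr_right fun _ => ?_
      omega

/-- After the turn below the starting vertex, the path sits just under it, jumps over it by a step
of two and walks to the end. -/
theorem pathOn_arm_exit (i : Fin 3) {a : ℕ} (ha : a < ℓ i) :
    (armGraph ℓ hℓ).PathOn (armSegment ℓ i 0 (ℓ i)) (armVertex i a ha.le)
      (armVertex i (ℓ i) le_rfl) := by
  cases a with
  | zero => exact pathOn_armSegment i (by omega) le_rfl
  | succ a =>
    refine ((pathOn_armSegment_turn i ha.le).append ?_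
      (pathOn_armSegment i (a := a + 2) (by omega) le_rfl) ?_).congr fun y => ?_
    · exact armGraph_adj.2 (.inl ⟨rfl, by simp [armAdj]⟩)
    · exact disjoint_armSegment_of_lt i i (by omega)
    · obtain ⟨j, c, hc, rfl⟩ := exists_eq_armVertex y
      simp only [Set.mem_union, armVertex_mem_armSegment, ← and_or_left]
      refine and_congr_right fun _ => ?_
      omega

/-- The arm of `x` is exhausted first, ending at its last vertex, or at its first one if `x` is the
last. The other two arms are then traversed lengthwise in opposite directions. -/
theorem armGraph_exists_pathOn_univ (x : ArmVertex ℓ) :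
    ∃ y, (armGraph ℓ hℓ).PathOn Set.univ x y := by
  obtain ⟨i, a, ha, rfl⟩ := exists_eq_armVertex x
  have i1 : i ≠ i + 1 := by clear * -; revert i; decide
  have i2 : i ≠ i + 2 := by clear * -; revert i; decide
  have i3 : i + 1 ≠ i + 2 := by clear * -; revert i; decide
  have hall : ∀ j, j = i ∨ j = i + 1 ∨ j = i + 2 := by clear * -; revert i; decide
  have hfull (j : Fin 3) := pathOn_armSegment (hℓ := hℓ) j (Nat.zero_le _) le_rfl
  have hd1 := disjoint_armSegment (ℓ := ℓ) i1 0 (ℓ i) 0 (ℓ (i + 1))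
  have hd2 := disjoint_armSegment (ℓ := ℓ) i2 0 (ℓ i) 0 (ℓ (i + 2))
  have hd3 := disjoint_armSegment (ℓ := ℓ) i3 0 (ℓ (i + 1)) 0 (ℓ (i + 2))
  have htop {j k : Fin 3} (h : j ≠ k) : (armGraph ℓ hℓ).Adj (armVertex j 0 (Nat.zero_le _))
      (armVertex k 0 (Nat.zero_le _)) := armGraph_adj.2 (.inr ⟨h, .inl ⟨rfl, rfl⟩⟩)
  have hbot {j k : Fin 3} (h : j ≠ k) : (armGraph ℓ hℓ).Adj (armVertex j (ℓ j) le_rfl)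
      (armVertex k (ℓ k) le_rfl) := armGraph_adj.2 (.inr ⟨h, .inr ⟨rfl, rfl⟩⟩)
  have huniv : ∀ y, y ∈ armSegment ℓ i 0 (ℓ i) ∪ armSegment ℓ (i + 1) 0 (ℓ (i + 1)) ∪
      armSegment ℓ (i + 2) 0 (ℓ (i + 2)) ↔ y ∈ Set.univ := by
    intro y
    obtain ⟨j, c, hc, rfl⟩ := exists_eq_armVertex y
    simp only [Set.mem_union, armVertex_mem_armSegment, Set.mem_univ, iff_true]
    rcases hall j with rfl | rfl | rfl <;> simp [hc]
  have hd : Disjoint (armSegment ℓ i 0 (ℓ i) ∪ armSegment ℓ (i + 1) 0 (ℓ (i + 1)))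
      (armSegment ℓ (i + 2) 0 (ℓ (i + 2))) := Set.disjoint_union_left.2 ⟨hd2, hd3⟩
  rcases ha.lt_or_eq with ha' | rfl
  · exact ⟨_, (((pathOn_arm_exit i ha').append (hbot i1) (hfull (i + 1)).symm hd1).append
      (htop i3) (hfull (i + 2)) hd).congr huniv⟩
  · exact ⟨_, (((hfull i).symm.append (htop i1) (hfull (i + 1)) hd1).append
      (hbot i3) (hfull (i + 2)).symm hd).congr huniv⟩

/-! ### The circumference -/

/-- A cycle misses the interior of at least one of the three arms. -/
theorem armGraph_exists_missed {z : ArmVertex ℓ} {p : (armGraph ℓ hℓ).Walk z z} (hp : p.IsCycle) :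
    ∃ i, ∀ x ∈ p.support, x ∉ armSegment ℓ i 1 (ℓ i - 1) := by
  by_contra! hcon
  choose x hx hxI using hcon
  have key : ∀ i, ∃ u ∈ armSegment ℓ i 1 (ℓ i - 1), ∃ j ≠ i,
      p.toSubgraph.neighborSet (armVertex i 0 (Nat.zero_le _)) =
        {u, armVertex j 0 (Nat.zero_le _)} := by
    intro i
    have hL := hℓ i
    have i1 : i + 1 ≠ i := by clear * -; revert i; decide
    have hbx : ∀ j, armVertex i (ℓ i) le_rfl ≠ x j := by
      intro j h
      have h' := hxI j
      rw [← h, armVertex_mem_armSegment] at h'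
      obtain ⟨rfl, h1, h2⟩ := h'
      omega
    have hy : ∀ a b, x (i + 1) ∉ armSegment ℓ i a b := fun a b h =>
      i1 ((hxI (i + 1)).1.symm.trans h.1)
    -- With the last vertex of the arm forbidden, the interior can be left only to the first vertex.
    obtain ⟨u, hu, w, hw, -, hwb, huw⟩ := hp.exists_adj_of_avoid (hx i) (hx (i + 1)) (hbx _)
      (hbx _) _ (hxI i) (hy _ _)
    have hwt : w = armVertex i 0 (Nat.zero_le _) := by
      have hadj := huw.adj_sub
      obtain ⟨j, a, ha, rfl⟩ := exists_eq_armVertex u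
      obtain ⟨k, b, hb, rfl⟩ := exists_eq_armVertex w
      rw [armVertex_mem_armSegment] at hu hw
      obtain ⟨rfl, hu⟩ := hu
      rw [armGraph_adj] at hadj
      rw [ne_eq, armVertex_inj] at hwb
      rw [armVertex_inj]
      rcases hadj with ⟨rfl, -⟩ | ⟨-, h⟩
      · simp only [true_and] at *
        omega
      · omega
    subst hwt
    -- The same with the first vertex added to the set: now the exit is an edge of the triangle of
    -- first vertices. The two exits are all the cycle edges at the first vertex of arm `i`.
    obtain ⟨u', hu', w', hw', -, hwb', huw'⟩ := hp.exists_adj_of_avoid (hx i) (hx (i + 1))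
      (hbx _) (hbx _) (armSegment ℓ i 0 (ℓ i - 1)) ⟨(hxI i).1, by omega, (hxI i).2.2⟩ (hy _ _)
    obtain ⟨j, hji, hu't, hw't⟩ : ∃ j, j ≠ i ∧ u' = armVertex i 0 (Nat.zero_le _) ∧
        w' = armVertex j 0 (Nat.zero_le _) := by
      have hadj := huw'.adj_sub
      obtain ⟨j, a, ha, rfl⟩ := exists_eq_armVertex u'
      obtain ⟨k, b, hb, rfl⟩ := exists_eq_armVertex w'
      rw [armVertex_mem_armSegment] at hu' hw'
      obtain ⟨rfl, hu'⟩ := hu'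
      rw [armGraph_adj] at hadj
      rw [ne_eq, armVertex_inj] at hwb'
      simp only [armVertex_inj]
      rcases hadj with ⟨rfl, -⟩ | ⟨hne, h⟩
      · simp only [true_and] at *
        omega
      · refine ⟨k, hne.symm, ?_⟩
        simp only [true_and]
        omega
    subst hu't hw't
    refine ⟨u, hu, j, hji, ?_⟩
    have hcard := hp.ncard_neighborSet_toSubgraph_eq_two
      (p.mem_support_of_adj_toSubgraph huw'.symm.symm)
    symm
    refine Set.eq_of_subset_of_ncard_le ?_ ?_ (Set.finite_of_ncard_ne_zero (by omega))
    · rintro y (rfl | rfl)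
      · exact huw.symm
      · exact huw'
    · rw [hcard, Set.ncard_pair]
      rintro rfl
      exact hji hu.1
  choose u hu f hf hN using key
  have hinv : ∀ i, f (f i) = i := by
    intro i
    have h1 : p.toSubgraph.Adj (armVertex i 0 (Nat.zero_le _))
        (armVertex (f i) 0 (Nat.zero_le _)) := by
      rw [← Subgraph.mem_neighborSet, hN]
      simp
    have h2 := h1.symm
    rw [← Subgraph.mem_neighborSet, hN] at h2
    rcases h2 with h2 | h2
    · have := hu (f i)
      rw [← h2, armVertex_mem_armSegment] at this
      omega
    · exact (armVertex_inj.1 h2).1.symm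
  -- A set of three elements has no involution without fixed points.
  revert hf hinv
  clear hN
  revert f
  decide

theorem armGraph_isCycle_length_le {z : ArmVertex ℓ} {p : (armGraph ℓ hℓ).Walk z z}
    (hp : p.IsCycle) : p.length ≤ Fintype.card (ArmVertex ℓ) - 4 := by
  classical
  obtain ⟨i, hi⟩ := armGraph_exists_missed hp
  have hL := hℓ i
  let S : Finset (ArmVertex ℓ) := {armVertex i 1 (by omega), armVertex i 2 (by omega),
    armVertex i 3 (by omega), armVertex i 4 (by omega)}
  have hS : S.card = 4 := by
    rw [← Set.ncard_coe_finset]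
    simp only [S, Finset.coe_insert, Finset.coe_singleton]
    rw [ncard_quadruple] <;> simp [armVertex_inj]
  have hlen : p.support.tail.toFinset.card = p.length := by
    rw [List.toFinset_card_of_nodup hp.support_nodup]
    simp
  have hsub : p.support.tail.toFinset ⊆ Sᶜ := by
    intro y hy
    rw [Finset.mem_compl]
    intro hyS
    refine hi y (List.mem_of_mem_tail (List.mem_toFinset.1 hy)) ?_
    simp only [S, Finset.mem_insert, Finset.mem_singleton] at hyS
    rcases hyS with rfl | rfl | rfl | rfl <;> rw [armVertex_mem_armSegment] <;> omega
  have := Finset.card_le_card hsub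
  rw [Finset.card_compl, hS, hlen] at this
  exact this

theorem armGraph_card_sub_four_mem (h2 : ℓ 2 = 5) :
    Fintype.card (ArmVertex ℓ) - 4 ∈ (armGraph ℓ hℓ).cycleLengths := by
  have htop {j k : Fin 3} (h : j ≠ k) : (armGraph ℓ hℓ).Adj (armVertex j 0 (Nat.zero_le _))
      (armVertex k 0 (Nat.zero_le _)) := armGraph_adj.2 (.inr ⟨h, .inl ⟨rfl, rfl⟩⟩)
  have hbot {j k : Fin 3} (h : j ≠ k) : (armGraph ℓ hℓ).Adj (armVertex j (ℓ j) le_rfl)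
      (armVertex k (ℓ k) le_rfl) := armGraph_adj.2 (.inr ⟨h, .inr ⟨rfl, rfl⟩⟩)
  have h0 := pathOn_armSegment (hℓ := hℓ) 0 (Nat.zero_le (ℓ 0)) le_rfl
  have h1 := (pathOn_armSegment (hℓ := hℓ) 1 (Nat.zero_le (ℓ 1)) le_rfl).symm
  have hl := pathOn_armSegment (hℓ := hℓ) 2 (le_refl (ℓ 2)) le_rfl
  have hz := pathOn_armSegment (hℓ := hℓ) 2 (le_refl 0) (Nat.zero_le _)
  -- Along arm 0, over the last vertex of arm 2, back along arm 1, to the first vertex of arm 2.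
  -- Only the four interior vertices of arm 2 are missed.
  have hpath := ((h0.append (hbot (by decide)) hl (disjoint_armSegment (by decide) _ _ _ _)).append
    (hbot (by decide)) h1 (Set.disjoint_union_left.2 ⟨disjoint_armSegment (by decide) _ _ _ _,
      disjoint_armSegment (by decide) _ _ _ _⟩)).append (htop (by decide)) hz
    (Set.disjoint_union_left.2 ⟨Set.disjoint_union_left.2
      ⟨disjoint_armSegment (by decide) _ _ _ _, (disjoint_armSegment_of_lt _ _ (by omega)).symm⟩,
      disjoint_armSegment (by decide) _ _ _ _⟩)
  let S : Set (ArmVertex ℓ) := {armVertex 2 1 (by omega), armVertex 2 2 (by omega),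
    armVertex 2 3 (by omega), armVertex 2 4 (by omega)}
  have hS : S.ncard = 4 := by
    rw [ncard_quadruple] <;> simp [armVertex_inj]
  have hcard : Sᶜ.ncard = Fintype.card (ArmVertex ℓ) - 4 := by
    rw [Set.ncard_compl, hS, Nat.card_eq_fintype_card]
  have hV : Fintype.card (ArmVertex ℓ) = ℓ 0 + 1 + (ℓ 1 + 1) + (ℓ 2 + 1) := by
    simp [Fin.sum_univ_three]
  have hpath' := hpath.congr (T := Sᶜ) fun y => by
    obtain ⟨j, c, hc, rfl⟩ := exists_eq_armVertex y
    simp only [S, Set.mem_union, armVertex_mem_armSegment, Set.mem_compl_iff, Set.mem_insert_iff,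
      Set.mem_singleton_iff, armVertex_inj]
    fin_cases j <;> simp at hc ⊢ <;> omega
  have := hℓ 0
  rw [← hcard]
  exact hpath'.ncard_mem_cycleLengths (htop (by decide)) (by omega)

theorem armGraph_circumference (h2 : ℓ 2 = 5) :
    (armGraph ℓ hℓ).circumference = Fintype.card (ArmVertex ℓ) - 4 := by
  refine IsGreatest.csSup_eq ⟨armGraph_card_sub_four_mem h2, ?_⟩
  rintro k ⟨v, p, hp, rfl⟩
  exact armGraph_isCycle_length_le hp

end

theorem exists_four_regular (p : ℕ) (hp : 18 ≤ p) :
    ∃ (G : SimpleGraph (Fin p)) (_ : DecidableRel G.Adj),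
      G.IsRegularOfDegree 4 ∧ G.HomogeneouslyTraceable ∧ G.circumference = p - 4 := by
  classical
  -- The arms have `p - 12`, 6 and 6 vertices; `18 ≤ p` is exactly what makes `5 ≤ p - 13`.
  let ℓ : Fin 3 → ℕ := ![p - 13, 5, 5]
  have hℓ : ∀ i, 5 ≤ ℓ i := by
    intro i
    fin_cases i <;> simp [ℓ]
    omega
  have hV : Fintype.card (ArmVertex ℓ) = p := by
    simp [Fin.sum_univ_three, ℓ]
    omega
  obtain ⟨G', ⟨e⟩⟩ := (armGraph ℓ hℓ).exists_iso_fin hV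
  refine ⟨G', Classical.decRel _, e.isRegularOfDegree armGraph_ncard_neighborSet,
    e.homogeneouslyTraceable (homogeneouslyTraceable_of_pathOn armGraph_exists_pathOn_univ), ?_⟩
  rw [e.circumference_eq, armGraph_circumference rfl, hV]

end SimpleGraph

theorem theorem3 :
    (∀ n : ℕ, Even n → 10 ≤ n →
      ∃ (G : SimpleGraph (Fin n)) (_ : DecidableRel G.Adj),
        G.IsRegularOfDegree 3 ∧ G.HomogeneouslyTraceable ∧ ¬ G.IsHamiltonian) ∧
    (∀ p : ℕ, 18 ≤ p →
      ∃ (G : SimpleGraph (Fin p)) (_ : DecidableRel G.Adj),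
        G.IsRegularOfDegree 4 ∧ G.HomogeneouslyTraceable ∧ G.circumference = p - 4) :=
  ⟨SimpleGraph.exists_cubic, SimpleGraph.exists_four_regular⟩
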